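/- Let $(\xi_k)_{k\in\mathbb Z}$ be a stationary Markov chain on a probability space $(\Omega,\mathcal F,P)$ with values in a measurable space $S$, with marginal law $\pi$ and transition kernel $Q$, and put $\mathcal F_k=\sigma(\xi_i : i\le k)$. Let $Q$ also denote the operator $(Qf)(x)=\int_S f(y)\,Q(x,dy)$ on $L^2(\pi)$, and assume that the chain is normal, i.e. $QQ^*=Q^*Q$. Let $f\in L^2_0(\pi)$, i.e. $f:S\to\mathbb R$, $\int f^2\,d\pi<\infty$ and $\int f\,d\pi=0$, and let $\rho_f$ be the spectral measure of $f$ with respect to the normal contraction $Q$ on the (complex) space $L^2(\pi)$, a finite Borel measure on the closed unit disk $D\subset\mathbb C$ with $\int \varphi\,d\rho_f=\langle \varphi(Q)f,f\rangle$ for all continuous $\varphi$. Assume that $$\int_D \frac{1}{|1-z|}\,\rho_f(dz)<\infty$$ (with $1/0=\infty$). Put $X_k=f(\xi_k)$ and $S_n=\sum_{i=0}^{n-1}X_i$. Then the partial sums admit a stationary martingale approximation: there are square-integrable random variables $(D_k)_{k\in\mathbb Z}$, stationary (jointly with the chain $(\xi_k)$), such that $M_n=\sum_{i=0}^{n-1}D_i$,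 $n\ge 0$, is a martingale with respect to $(\mathcal F_n)_{n\ge0}$ and $$\frac{1}{n}\,E\bigl[(S_n-M_n)^2\bigr]\longrightarrow 0\qquad (n\to\infty).$$ -/

import Mathlib

open MeasureTheory ProbabilityTheory Filter Topology

open scoped ENNReal

/-! ### Stationary Markov chains -/

/-- The random elements `X k`, `k ∈ ℤ`, are measurable and the law of the path `(X k)` is invariant
under the time shift. -/
structure IsStationaryProcess {Ω E : Type*} [MeasurableSpace Ω] [MeasurableSpace E]
    (P : Measure Ω) (X : ℤ → Ω → E) : Prop where
  measurable : ∀ k, Measurable (X k)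
  shift_law : P.map (fun ω k => X (k + 1) ω) = P.map (fun ω k => X k ω)

/-- The `σ`-algebra generated by the variables `ξ i`, `i ≤ k`. -/
abbrev pastSigma {Ω S : Type*} [mS : MeasurableSpace S] (ξ : ℤ → Ω → S) (k : ℤ) :
    MeasurableSpace Ω :=
  ⨆ i : {i : ℤ // i ≤ k}, MeasurableSpace.comap (ξ i) mS

/-- `ξ` is a stationary Markov chain indexed by `ℤ`, with marginal law `π` and
transition kernel `Q`. -/
structure IsStationaryMarkovChain {Ω S : Type*} [MeasurableSpace Ω] [MeasurableSpace S]
    (P : Measure Ω) (ξ : ℤ → Ω → S) (π : Measure S) (Q : Kernel S S) : Prop where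
  stationary : IsStationaryProcess P ξ
  law : P.map (ξ 0) = π
  markov : ∀ (k : ℤ) (A : Set S), MeasurableSet A →
    P[(ξ (k + 1) ⁻¹' A).indicator (fun _ => (1 : ℝ)) | pastSigma ξ k]
      =ᵐ[P] fun ω => (Q (ξ k ω)).real A

theorem pastSigma_mono {Ω S : Type*} [MeasurableSpace S] (ξ : ℤ → Ω → S) :
    Monotone (pastSigma ξ) := fun _ l hkl =>
  iSup_le fun i => le_iSup (fun j : {j : ℤ // j ≤ l} => MeasurableSpace.comap (ξ j) _)
    ⟨i.1, i.2.trans hkl⟩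

theorem pastSigma_le {Ω S : Type*} [mΩ : MeasurableSpace Ω] [MeasurableSpace S]
    {ξ : ℤ → Ω → S} (hξ : ∀ k, Measurable (ξ k)) (k : ℤ) : pastSigma ξ k ≤ mΩ :=
  iSup_le fun i => (hξ i).comap_le

/-- The filtration `(𝓕 n)`, `n ∈ ℕ`, with `𝓕 n` generated by `ξ i`, `i ≤ n`, `i ∈ ℤ`. -/
def pastFiltration {Ω S : Type*} [mΩ : MeasurableSpace Ω] [MeasurableSpace S]
    (ξ : ℤ → Ω → S) (hξ : ∀ k, Measurable (ξ k)) : Filtration ℕ mΩ where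
  seq n := pastSigma ξ n
  mono' _ _ h := pastSigma_mono ξ (Int.ofNat_le.mpr h)
  le' n := pastSigma_le hξ n

theorem IsStationaryMarkovChain.invariant {Ω S : Type*} [MeasurableSpace Ω] [MeasurableSpace S]
    {P : Measure Ω} [IsProbabilityMeasure P] {ξ : ℤ → Ω → S} {π : Measure S} {Q : Kernel S S}
    [IsMarkovKernel Q] (h : IsStationaryMarkovChain P ξ π Q) : Q.Invariant π := by
  have hm := h.stationary.measurable
  have h1 : P.map (ξ 1) = π := by
    have hs := congrArg (fun ν : Measure (ℤ → S) => ν.map (fun x => x 0)) h.stationary.shift_law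
    rw [Measure.map_map (measurable_pi_apply 0) (measurable_pi_lambda _ fun k => hm (k + 1)),
      Measure.map_map (measurable_pi_apply 0) (measurable_pi_lambda _ fun k => hm k)] at hs
    exact hs.trans h.law
  have : IsProbabilityMeasure π :=
    h.law ▸ Measure.isProbabilityMeasure_map (hm 0).aemeasurable
  refine Measure.ext fun A hA => ?_
  have h2 : ∫ ω, (Q (ξ 0 ω)).real A ∂P = P.real (ξ 1 ⁻¹' A) := by
    rw [← integral_congr_ae (h.markov 0 A hA), integral_condExp (pastSigma_le hm 0)]
    rw [integral_indicator_const _ (hm _ hA)]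
    simp
  have h3 : ∫ ω, (Q (ξ 0 ω)).real A ∂P = ∫ x, (Q x).real A ∂π := by
    rw [← h.law, integral_map (hm 0).aemeasurable]
    exact (Q.measurable_coe hA).ennreal_toReal.aestronglyMeasurable
  have h4 : ∫ x, (Q x).real A ∂π = ((π.bind Q) A).toReal := by
    rw [Measure.bind_apply hA Q.aemeasurable]
    exact integral_toReal (Q.measurable_coe hA).aemeasurable
      (Eventually.of_forall fun x => measure_lt_top _ _)
  have h5 : P.real (ξ 1 ⁻¹' A) = (π A).toReal := by
    rw [← h1, Measure.map_apply (hm 1) hA]; rfl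
  exact (ENNReal.toReal_eq_toReal_iff' (measure_ne_top (Q ∘ₘ π) A) (measure_ne_top π A)).mp
    (by rw [← h4, ← h3, h2, h5])

/-! ### The Markov operator on complex `L²(π)` -/

theorem ae_ae_of_invariant {S : Type*} [MeasurableSpace S] {π : Measure S} {Q : Kernel S S}
    (h : Q.Invariant π) {p : S → Prop} (hp : ∀ᵐ y ∂π, p y) :
    ∀ᵐ x ∂π, ∀ᵐ y ∂(Q x), p y := by
  refine Measure.ae_ae_of_ae_comp ?_
  rw [h.def]
  exact hp

theorem lintegral_of_invariant {S : Type*} [MeasurableSpace S] {π : Measure S} {Q : Kernel S S}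
    (h : Q.Invariant π) {g : S → ℝ≥0∞} (hg : AEMeasurable g π) :
    ∫⁻ x, ∫⁻ y, g y ∂(Q x) ∂π = ∫⁻ y, g y ∂π := by
  have hg2 : AEMeasurable g (π.bind Q) := by rw [h.def]; exact hg
  rw [← Measure.lintegral_bind Q.aemeasurable hg2, h.def]

theorem ae_memLp_of_invariant {S : Type*} [MeasurableSpace S] {π : Measure S} {Q : Kernel S S}
    (h : Q.Invariant π) {f : S → ℂ} (hf : MemLp f 2 π) : ∀ᵐ x ∂π, MemLp f 2 (Q x) := by
  have hfm := hf.1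
  have hfin : ∫⁻ x, ∫⁻ y, ‖f y‖ₑ ^ (2 : ℝ) ∂(Q x) ∂π ≠ ∞ := by
    rw [lintegral_of_invariant h (hfm.enorm.pow_const _)]
    simpa using (lintegral_rpow_enorm_lt_top_of_eLpNorm_lt_top two_ne_zero ENNReal.ofNat_ne_top
      hf.2).ne
  have hmeas : AEMeasurable (fun x => ∫⁻ y, ‖f y‖ₑ ^ (2 : ℝ) ∂(Q x)) π := by
    refine ⟨fun x => ∫⁻ y, ‖hfm.mk f y‖ₑ ^ (2 : ℝ) ∂(Q x),
      (hfm.stronglyMeasurable_mk.enorm.pow_const _).lintegral_kernel, ?_⟩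
    filter_upwards [ae_ae_of_invariant h hfm.ae_eq_mk] with x hx
    exact lintegral_congr_ae (by filter_upwards [hx] with y hy; rw [hy])
  filter_upwards [ae_ae_of_invariant h hfm.ae_eq_mk, ae_lt_top' hmeas hfin] with x hx hx2
  refine ⟨⟨hfm.mk f, hfm.stronglyMeasurable_mk, hx⟩, ?_⟩
  exact (eLpNorm_lt_top_iff_lintegral_rpow_enorm_lt_top two_ne_zero ENNReal.ofNat_ne_top).mpr
    (by simpa using hx2)

theorem eLpNorm_kernel_integral_le {S : Type*} [MeasurableSpace S] {π : Measure S}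
    {Q : Kernel S S} [IsMarkovKernel Q] (h : Q.Invariant π) {f : S → ℂ} (hf : MemLp f 2 π) :
    eLpNorm (fun x => ∫ y, f y ∂(Q x)) 2 π ≤ eLpNorm f 2 π := by
  rw [eLpNorm_eq_lintegral_rpow_enorm_toReal two_ne_zero ENNReal.ofNat_ne_top,
    eLpNorm_eq_lintegral_rpow_enorm_toReal two_ne_zero ENNReal.ofNat_ne_top]
  refine ENNReal.rpow_le_rpow ?_ (by simp)
  rw [← lintegral_of_invariant h (hf.1.enorm.pow_const _)]
  refine lintegral_mono_ae ?_
  filter_upwards [ae_memLp_of_invariant h hf] with x hx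
  have h1 : ‖∫ y, f y ∂(Q x)‖ₑ ≤ eLpNorm f 2 (Q x) :=
    (enorm_integral_le_lintegral_enorm f).trans
      ((eLpNorm_one_eq_lintegral_enorm (f := f)).symm.le.trans
        (eLpNorm_le_eLpNorm_of_exponent_le (by norm_num) hx.1))
  refine (ENNReal.rpow_le_rpow h1 (by simp)).trans ?_
  rw [eLpNorm_eq_lintegral_rpow_enorm_toReal two_ne_zero ENNReal.ofNat_ne_top,
    ← ENNReal.rpow_mul]
  simp

theorem memLp_kernel_integral {S : Type*} [MeasurableSpace S] {π : Measure S}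
    {Q : Kernel S S} [IsMarkovKernel Q] (h : Q.Invariant π) {f : S → ℂ} (hf : MemLp f 2 π) :
    MemLp (fun x => ∫ y, f y ∂(Q x)) 2 π := by
  refine ⟨⟨fun x => ∫ y, hf.1.mk f y ∂(Q x), hf.1.stronglyMeasurable_mk.integral_kernel, ?_⟩,
    (eLpNorm_kernel_integral_le h hf).trans_lt hf.2⟩
  filter_upwards [ae_ae_of_invariant h hf.1.ae_eq_mk] with x hx using integral_congr_ae hx

/-- The operator `(Q f)(x) = ∫ f(y) Q(x, dy)` on the complex Hilbert space `L²(π)`, for a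
Markov kernel `Q` with invariant measure `π`. -/
noncomputable def markovOperator {S : Type*} [MeasurableSpace S] {π : Measure S}
    {Q : Kernel S S} [IsMarkovKernel Q] (h : Q.Invariant π) : Lp ℂ 2 π →L[ℂ] Lp ℂ 2 π :=
  LinearMap.mkContinuous
    { toFun := fun f => (memLp_kernel_integral h (Lp.memLp f)).toLp _
      map_add' := fun f g => by
        rw [← MemLp.toLp_add]
        refine (MemLp.toLp_eq_toLp_iff _ _).mpr ?_
        filter_upwards [ae_ae_of_invariant h (Lp.coeFn_add f g),
          ae_memLp_of_invariant h (Lp.memLp f), ae_memLp_of_invariant h (Lp.memLp g)]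
          with x hx hf hg
        rw [integral_congr_ae hx]
        exact integral_add (hf.integrable (by norm_num)) (hg.integrable (by norm_num))
      map_smul' := fun c f => by
        rw [RingHom.id_apply, ← MemLp.toLp_const_smul]
        refine (MemLp.toLp_eq_toLp_iff _ _).mpr ?_
        filter_upwards [ae_ae_of_invariant h (Lp.coeFn_smul c f)] with x hx
        rw [integral_congr_ae hx]
        exact integral_smul c _ }
    1 (fun f => by
      rw [one_mul]
      change ‖(memLp_kernel_integral h (Lp.memLp f)).toLp _‖ ≤ ‖f‖
      rw [Lp.norm_toLp, Lp.norm_def]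
      exact ENNReal.toReal_mono (Lp.eLpNorm_ne_top f)
        (eLpNorm_kernel_integral_le h (Lp.memLp f)))

/-! ### The spectral measure of a vector with respect to a normal operator -/

open scoped ComplexOrder in
theorem cfcHom_ofReal_nonneg {H : Type*} [NormedAddCommGroup H] [InnerProductSpace ℂ H]
    [CompleteSpace H] (T : H →L[ℂ] H) (hT : IsStarNormal T) {φ : C(spectrum ℂ T, ℝ)}
    (hφ : ∀ x, 0 ≤ φ x) :
    0 ≤ cfcHom hT ((⟨Complex.ofReal, Complex.continuous_ofReal⟩ : C(ℝ, ℂ)).comp φ) := by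
  rw [cfcHom_nonneg_iff hT]
  intro x
  exact Complex.zero_le_real.mpr (hφ x)

/-- The positive functional `φ ↦ ⟪v, φ(T) v⟫` on real continuous functions on the spectrum of the
normal operator `T`, with `φ(T)` given by the continuous functional calculus. -/
noncomputable def spectralFunctional {H : Type*} [NormedAddCommGroup H] [InnerProductSpace ℂ H]
    [CompleteSpace H] (T : H →L[ℂ] H) (hT : IsStarNormal T) (v : H) :
    CompactlySupportedContinuousMap (spectrum ℂ T) ℝ →ₚ[ℝ] ℝ :=
  PositiveLinearMap.mk₀
    { toFun := fun φ => (inner ℂ v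
        (cfcHom hT ((⟨Complex.ofReal, Complex.continuous_ofReal⟩ : C(ℝ, ℂ)).comp
          φ.toContinuousMap) v)).re
      map_add' := fun φ ψ => by
        have : (⟨Complex.ofReal, Complex.continuous_ofReal⟩ : C(ℝ, ℂ)).comp
            (φ + ψ).toContinuousMap
            = (⟨Complex.ofReal, Complex.continuous_ofReal⟩ : C(ℝ, ℂ)).comp φ.toContinuousMap
              + (⟨Complex.ofReal, Complex.continuous_ofReal⟩ : C(ℝ, ℂ)).comp
                ψ.toContinuousMap := by
          ext x; simp
        rw [this, map_add]
        simp
      map_smul' := fun c φ => by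
        have : (⟨Complex.ofReal, Complex.continuous_ofReal⟩ : C(ℝ, ℂ)).comp
            (c • φ).toContinuousMap
            = (c : ℂ) • (⟨Complex.ofReal, Complex.continuous_ofReal⟩ : C(ℝ, ℂ)).comp
              φ.toContinuousMap := by
          ext x; simp
        rw [this, map_smul]
        simp }
    (fun φ hφ => by
      have h0 := cfcHom_ofReal_nonneg T hT (φ := φ.toContinuousMap) hφ
      exact (((ContinuousLinearMap.nonneg_iff_isPositive _).mp h0).re_inner_nonneg_right v))

/-- The spectral measure `ρ_v` of the vector `v` with respect to the normal operator `T`: the Borel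
measure on `ℂ`, carried by the spectrum of `T`, with `∫ φ dρ_v = ⟪v, φ(T) v⟫` for all continuous
functions `φ` on the spectrum. -/
noncomputable def spectralMeasure {H : Type*} [NormedAddCommGroup H] [InnerProductSpace ℂ H]
    [CompleteSpace H] (T : H →L[ℂ] H) (hT : IsStarNormal T) (v : H) : Measure ℂ :=
  (RealRMK.rieszMeasure (spectralFunctional T hT v)).map Subtype.val

/-! ### Martingale approximation -/

/-- The partial sum `∑_{0 ≤ i < n} X_i`. -/
def partialSum {Ω : Type*} (X : ℤ → Ω → ℝ) (n : ℕ) (ω : Ω) : ℝ :=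
  ∑ i ∈ Finset.range n, X i ω

/-- The partial sums of `X` admit a stationary martingale approximation along the chain `ξ`:
there are square integrable variables `D k` such that `(D k)` is stationary jointly with `ξ`
(so `D k` is the image of `D 0` under the `k`-th power of the shift along `ξ`), the sums
`M n = ∑_{0 ≤ i < n} D i` form a martingale for `𝓕 n = σ(ξ i, i ≤ n)`, and
`E[(S n - M n)²] / n → 0`. -/
def HasMartingaleApproximation {Ω S : Type*} [MeasurableSpace Ω] [MeasurableSpace S]
    (P : Measure Ω) (ξ : ℤ → Ω → S) (hξ : ∀ k, Measurable (ξ k)) (X : ℤ → Ω → ℝ) : Prop :=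
  ∃ D : ℤ → Ω → ℝ,
    (∀ k, MemLp (D k) 2 P) ∧
    IsStationaryProcess P (fun k ω => (ξ k ω, D k ω)) ∧
    Martingale (partialSum D) (pastFiltration ξ hξ) P ∧
    Tendsto (fun n : ℕ => (∫ ω, (partialSum X n ω - partialSum D n ω) ^ 2 ∂P) / n) atTop (𝓝 0)

/-! ### Integrals against the spectral measure -/

/-! This is the resolvent method of martingale approximation. For `ε > 0` put `g = (1 + ε - Q)⁻¹ f`,
so that `f = (1 + ε) g - Q g`. Then `f(ξ_i)` is the sum of the martingale difference `g(ξ_{i+1}) -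
(Q g)(ξ_i)`, the telescoping term `g(ξ_i) - g(ξ_{i+1})` and the small term `ε g(ξ_i)`. The
approximating martingale comes from the limit `d` of these differences as `ε → 0`; the functions `g`
themselves need not converge.

Two spectral facts make this work. The difference has squared norm `‖g‖² - ‖Q g‖²`
(`norm_differenceOp_sq`), which is the integral of `(1 - |z|²) / |1 + ε - z|²` against the spectral
measure. On the disk `1 - |z|² ≤ 2 |1 - z|`, so the weight cancels one power of the singularity at
`1`, and dominated convergence with majorant a multiple of `1 / |1 - z|` makes the differences
Cauchy in `L²(π ⊗ Q)` (`tendsto_resolventDefect`). In the same way `ε / |1 + ε - z|² ≤ 1 / |1 - z|`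
gives `ε ‖g‖² → 0` (`tendsto_norm_resolventSeq`).

With `ε = 1 / (n + 1)`, orthogonality of martingale differences bounds the error after `n` steps by
a multiple of `n ‖d_ε - d‖² + ‖g‖²`, where `d_ε` is the difference built from `g`
(`norm_sum_evalAt_sub_le`). Divided by `n`, both terms vanish. -/

section Spectral

variable {H : Type*} [NormedAddCommGroup H] [InnerProductSpace ℂ H] [CompleteSpace H]

/-- The spectral measure of `v`, as a measure on the spectrum of `T`. -/
noncomputable def spectrumMeasure (T : H →L[ℂ] H) (hT : IsStarNormal T) (v : H) :
    Measure (spectrum ℂ T) :=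
  RealRMK.rieszMeasure (spectralFunctional T hT v)

instance isFiniteMeasure_spectrumMeasure (T : H →L[ℂ] H) (hT : IsStarNormal T) (v : H) :
    IsFiniteMeasure (spectrumMeasure T hT v) := by
  unfold spectrumMeasure
  infer_instance

theorem integral_spectrumMeasure (T : H →L[ℂ] H) (hT : IsStarNormal T) (v : H)
    (φ : C(spectrum ℂ T, ℝ)) :
    ∫ z, φ z ∂spectrumMeasure T hT v = (inner ℂ v
      (cfcHom hT ((⟨Complex.ofReal, Complex.continuous_ofReal⟩ : C(ℝ, ℂ)).comp φ) v)).re :=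
  RealRMK.integral_rieszMeasure (spectralFunctional T hT v)
    ⟨φ, HasCompactSupport.of_compactSpace _⟩

/-- Normality enters here: the functional calculus is a star homomorphism, so the squared norm
equals `⟪v, (star ψ * ψ)(T) v⟫`, and `star ψ * ψ = |ψ|²`. -/
theorem norm_cfcHom_apply_sq (T : H →L[ℂ] H) (hT : IsStarNormal T) (v : H)
    (ψ : C(spectrum ℂ T, ℂ)) :
    ‖cfcHom hT ψ v‖ ^ 2 = ∫ z, ‖ψ z‖ ^ 2 ∂spectrumMeasure T hT v := by
  have h := integral_spectrumMeasure T hT v ⟨fun z => ‖ψ z‖ ^ 2, by fun_prop⟩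
  have h2 : ((⟨Complex.ofReal, Complex.continuous_ofReal⟩ : C(ℝ, ℂ)).comp
      (⟨fun z => ‖ψ z‖ ^ 2, by fun_prop⟩ : C(spectrum ℂ T, ℝ))) = star ψ * ψ := by
    ext z
    simp [Complex.conj_mul']
  rw [h2, map_mul, map_star] at h
  rw [mul_apply_eq_comp, ContinuousLinearMap.star_eq_adjoint,
    ContinuousLinearMap.adjoint_inner_right, inner_self_eq_norm_sq_to_K] at h
  rw [← ContinuousMap.coe_mk (fun z => ‖ψ z‖ ^ 2) (by fun_prop), h]
  norm_cast

/-! ### Resolvents of a normal contraction. -/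

theorem norm_le_one_of_mem_spectrum {T : H →L[ℂ] H} (hT1 : ‖T‖ ≤ 1) (z : spectrum ℂ T) :
    ‖(z : ℂ)‖ ≤ 1 :=
  (spectrum.norm_le_norm_mul_of_mem z.2).trans <|
    mul_le_one₀ hT1 (norm_nonneg _) ContinuousLinearMap.norm_id_le

theorem le_norm_one_add_sub {z : ℂ} (hz : ‖z‖ ≤ 1) {ε : ℝ} : ε ≤ ‖1 + (ε : ℂ) - z‖ := by
  have h1 := Complex.re_le_norm z
  have h2 := Complex.re_le_norm (1 + (ε : ℂ) - z)
  simp at h2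
  linarith

/-- Since `Re z ≤ 1`, moving from `1` to the right along the real axis increases the distance to
`z`. -/
theorem norm_one_sub_le {z : ℂ} (hz : ‖z‖ ≤ 1) {ε : ℝ} (hε : 0 ≤ ε) :
    ‖1 - z‖ ≤ ‖1 + (ε : ℂ) - z‖ := by
  have h1 := Complex.re_le_norm z
  rw [← sq_le_sq₀ (norm_nonneg _) (norm_nonneg _), ← Complex.normSq_eq_norm_sq,
    ← Complex.normSq_eq_norm_sq, Complex.normSq_apply, Complex.normSq_apply]
  simp
  nlinarith

/-- The function `z ↦ 1 / (1 + ε - z)` on the spectrum of a contraction. -/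
noncomputable def resolventFun (T : H →L[ℂ] H) (hT1 : ‖T‖ ≤ 1) (ε : ℝ) (hε : 0 < ε) :
    C(spectrum ℂ T, ℂ) :=
  ⟨fun z => (1 + (ε : ℂ) - z)⁻¹, by
    refine Continuous.inv₀ (by fun_prop) fun z h => ?_
    have := le_norm_one_add_sub (norm_le_one_of_mem_spectrum hT1 z) (ε := ε)
    rw [h, norm_zero] at this
    linarith⟩

/-- The vector `(1 + ε - T)⁻¹ v`. -/
noncomputable def resolventVec (T : H →L[ℂ] H) (hT : IsStarNormal T) (hT1 : ‖T‖ ≤ 1) (v : H)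
    (ε : ℝ) (hε : 0 < ε) : H :=
  cfcHom hT (resolventFun T hT1 ε hε) v

theorem resolventVec_eq (T : H →L[ℂ] H) (hT : IsStarNormal T) (hT1 : ‖T‖ ≤ 1) (v : H)
    (ε : ℝ) (hε : 0 < ε) :
    v = (1 + (ε : ℂ)) • resolventVec T hT hT1 v ε hε - T (resolventVec T hT hT1 v ε hε) := by
  have h : (1 + (ε : ℂ)) • resolventFun T hT1 ε hε
      - (ContinuousMap.id ℂ).restrict (spectrum ℂ T) * resolventFun T hT1 ε hε = 1 := by
    ext z
    have h0 : 1 + (ε : ℂ) - z ≠ 0 := fun h => by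
      have := le_norm_one_add_sub (norm_le_one_of_mem_spectrum hT1 z) (ε := ε)
      rw [h, norm_zero] at this
      linarith
    simp only [resolventFun, ContinuousMap.sub_apply, ContinuousMap.smul_apply,
      ContinuousMap.mul_apply, ContinuousMap.coe_mk, ContinuousMap.restrict_apply,
      ContinuousMap.id_apply, ContinuousMap.one_apply, smul_eq_mul]
    rw [← sub_mul, mul_inv_cancel₀ h0]
  have h2 := congrArg (fun ψ => cfcHom hT ψ v) h
  simp only [map_sub, map_smul, map_mul, cfcHom_id hT, map_one] at h2
  exact h2.symm

/-- For the Markov operator the left side is the squared norm of a martingale difference; this is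
the source of the weight `1 - |z|²`. -/
theorem norm_cfcHom_sq_sub (T : H →L[ℂ] H) (hT : IsStarNormal T) (v : H)
    (ψ : C(spectrum ℂ T, ℂ)) :
    ‖cfcHom hT ψ v‖ ^ 2 - ‖T (cfcHom hT ψ v)‖ ^ 2
      = ∫ z, (1 - ‖(z : ℂ)‖ ^ 2) * ‖ψ z‖ ^ 2 ∂spectrumMeasure T hT v := by
  obtain ⟨χ, hχ, h1⟩ : ∃ χ : C(spectrum ℂ T, ℂ), (∀ z, ‖χ z‖ = ‖(z : ℂ)‖ * ‖ψ z‖) ∧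
      T (cfcHom hT ψ v) = cfcHom hT χ v := by
    refine ⟨(ContinuousMap.id ℂ).restrict (spectrum ℂ T) * ψ, fun z => ?_, ?_⟩
    · exact norm_mul _ _
    · rw [map_mul, cfcHom_id hT]
      rfl
  have hi : ∀ φ : C(spectrum ℂ T, ℂ), Integrable (fun z => ‖φ z‖ ^ 2) (spectrumMeasure T hT v) :=
    fun φ => Continuous.integrable_of_hasCompactSupport (by fun_prop)
      (HasCompactSupport.of_compactSpace _)
  rw [h1, norm_cfcHom_apply_sq, norm_cfcHom_apply_sq, ← integral_sub (hi ψ) (hi χ)]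
  refine integral_congr_ae (Eventually.of_forall fun z => ?_)
  dsimp only
  rw [hχ]
  ring

/-! ### Letting the resolvent parameter tend to zero. -/

variable {T : H →L[ℂ] H} {hT : IsStarNormal T} {v : H}

theorem lintegral_spectralMeasure (hT1 : ‖T‖ ≤ 1) {g : ℂ → ℝ≥0∞} (hg : Measurable g) :
    ∫⁻ z in Metric.closedBall (0 : ℂ) 1, g z ∂spectralMeasure T hT v
      = ∫⁻ z, g z ∂spectrumMeasure T hT v := by
  have hm : Measurable (Subtype.val : spectrum ℂ T → ℂ) := measurable_subtype_coe
  change ∫⁻ z in Metric.closedBall (0 : ℂ) 1, g z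
    ∂((spectrumMeasure T hT v).map Subtype.val) = _
  rw [setLIntegral_map measurableSet_closedBall hg hm]
  have : (Subtype.val : spectrum ℂ T → ℂ) ⁻¹' Metric.closedBall 0 1 = Set.univ :=
    Set.eq_univ_of_forall fun z => by
      simpa using norm_le_one_of_mem_spectrum hT1 z
  rw [this, setLIntegral_univ]

theorem integrable_inv_norm_one_sub
    (h : ∫⁻ z, ‖1 - (z : ℂ)‖ₑ⁻¹ ∂spectrumMeasure T hT v < ∞) :
    Integrable (fun z : spectrum ℂ T => ‖1 - (z : ℂ)‖⁻¹) (spectrumMeasure T hT v) := by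
  refine ⟨Measurable.aestronglyMeasurable (by fun_prop), lt_of_le_of_lt (lintegral_mono
    fun z => ?_) h⟩
  -- At `z = 1` the real inverse is `0` and the extended one is `∞`, so the bound still holds.
  by_cases hz : 1 - (z : ℂ) = 0
  · simp [hz]
  · rw [enorm_inv (by simpa using hz), enorm_norm]

/-- The integrand is `∞` at `z = 1`, so that point carries no mass. -/
theorem ae_one_sub_ne_zero (h : ∫⁻ z, ‖1 - (z : ℂ)‖ₑ⁻¹ ∂spectrumMeasure T hT v < ∞) :
    ∀ᵐ z : spectrum ℂ T ∂spectrumMeasure T hT v, 1 - (z : ℂ) ≠ 0 := by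
  filter_upwards [ae_lt_top (by fun_prop) h.ne] with z hz h0
  simp [h0] at hz

theorem resolventFun_norm_sub_le (hT1 : ‖T‖ ≤ 1) {ε : ℝ} (hε : 0 < ε) (z : spectrum ℂ T)
    (h0 : 1 - (z : ℂ) ≠ 0) :
    ‖resolventFun T hT1 ε hε z - (1 - (z : ℂ))⁻¹‖ ≤ ‖1 - (z : ℂ)‖⁻¹ := by
  have h1 := le_norm_one_add_sub (norm_le_one_of_mem_spectrum hT1 z) (ε := ε)
  have h2 : 1 + (ε : ℂ) - z ≠ 0 := norm_pos_iff.mp (hε.trans_le h1)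
  have : resolventFun T hT1 ε hε z - (1 - (z : ℂ))⁻¹
      = -(ε / (1 + (ε : ℂ) - z)) * (1 - (z : ℂ))⁻¹ := by
    change (1 + (ε : ℂ) - z)⁻¹ - (1 - (z : ℂ))⁻¹ = _
    field_simp
    ring
  rw [this, norm_mul, norm_neg, norm_div, Complex.norm_real, Real.norm_of_nonneg hε.le, norm_inv]
  exact mul_le_of_le_one_left (by positivity) (div_le_one_of_le₀ h1 (norm_nonneg _))

theorem tendsto_inv_nat_succ : Tendsto (fun n : ℕ => ((n : ℝ) + 1)⁻¹) atTop (𝓝 0) := by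
  simpa using tendsto_one_div_add_atTop_nhds_zero_nat (𝕜 := ℝ)

/-- The vectors `(1 + 1 / (n + 1) - T)⁻¹ v`. -/
noncomputable def resolventSeq (T : H →L[ℂ] H) (hT : IsStarNormal T) (hT1 : ‖T‖ ≤ 1) (v : H)
    (n : ℕ) : H :=
  resolventVec T hT hT1 v ((n : ℝ) + 1)⁻¹ (by positivity)

theorem tendsto_resolventFun (hT1 : ‖T‖ ≤ 1) (z : spectrum ℂ T) (h0 : 1 - (z : ℂ) ≠ 0) :
    Tendsto (fun n : ℕ => resolventFun T hT1 ((n : ℝ) + 1)⁻¹ (by positivity) z) atTop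
      (𝓝 (1 - (z : ℂ))⁻¹) := by
  change Tendsto (fun n : ℕ => (1 + (((n : ℝ) + 1)⁻¹ : ℝ) - (z : ℂ))⁻¹) atTop _
  refine Tendsto.inv₀ ?_ h0
  have := (Complex.continuous_ofReal.tendsto 0).comp tendsto_inv_nat_succ
  simpa using (this.const_add 1).sub_const (z : ℂ)

/-- Of the two factors `|1 + ε - z|⁻¹`, one is absorbed by `ε` and the other is at most `|1 - z|⁻¹`,
which is an integrable majorant. -/
theorem tendsto_norm_resolventSeq (hT1 : ‖T‖ ≤ 1)
    (h : ∫⁻ z, ‖1 - (z : ℂ)‖ₑ⁻¹ ∂spectrumMeasure T hT v < ∞) :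
    Tendsto (fun n : ℕ => ((n : ℝ) + 1)⁻¹ * ‖resolventSeq T hT hT1 v n‖ ^ 2) atTop (𝓝 0) := by
  have h1 : ∀ n : ℕ, ((n : ℝ) + 1)⁻¹ * ‖resolventSeq T hT hT1 v n‖ ^ 2
      = ∫ z, ((n : ℝ) + 1)⁻¹ * ‖resolventFun T hT1 ((n : ℝ) + 1)⁻¹ (by positivity) z‖ ^ 2
        ∂spectrumMeasure T hT v := fun n => by
    rw [integral_const_mul, ← norm_cfcHom_apply_sq]
    rfl
  simp_rw [h1]
  rw [← integral_zero (spectrum ℂ T) ℝ (μ := spectrumMeasure T hT v)]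
  refine tendsto_integral_of_dominated_convergence (fun z => ‖1 - (z : ℂ)‖⁻¹) (fun n => ?_)
    (integrable_inv_norm_one_sub h) (fun n => ?_) ?_
  · exact Continuous.aestronglyMeasurable (by fun_prop)
  · filter_upwards [ae_one_sub_ne_zero h] with z hz
    have hε : 0 < ((n : ℝ) + 1)⁻¹ := by positivity
    have h2 := le_norm_one_add_sub (norm_le_one_of_mem_spectrum hT1 z) (ε := ((n : ℝ) + 1)⁻¹)
    have h3 := norm_one_sub_le (norm_le_one_of_mem_spectrum hT1 z) hε.le
    have h4 : ‖resolventFun T hT1 ((n : ℝ) + 1)⁻¹ hε z‖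
      = ‖1 + (((n : ℝ) + 1)⁻¹ : ℝ) - (z : ℂ)‖⁻¹ := norm_inv _
    rw [Real.norm_of_nonneg (by positivity), h4, sq, ← mul_assoc]
    refine (mul_le_of_le_one_left (by positivity) ?_).trans
      (inv_anti₀ (norm_pos_iff.mpr hz) h3)
    rw [← div_eq_mul_inv]
    exact div_le_one_of_le₀ h2 (norm_nonneg _)
  · filter_upwards [ae_one_sub_ne_zero h] with z hz
    simpa using tendsto_inv_nat_succ.mul ((tendsto_resolventFun hT1 z hz).norm.pow 2)

/-- The distance in the seminorm `∫ (1 - |z|²) |·|² dρ` of the resolvent functions to their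
limit. -/
noncomputable def resolventDefect (T : H →L[ℂ] H) (hT : IsStarNormal T) (hT1 : ‖T‖ ≤ 1) (v : H)
    (n : ℕ) : ℝ :=
  ∫ z, (1 - ‖(z : ℂ)‖ ^ 2) *
    ‖resolventFun T hT1 ((n : ℝ) + 1)⁻¹ (by positivity) z - (1 - (z : ℂ))⁻¹‖ ^ 2
      ∂spectrumMeasure T hT v

/-- The weight satisfies `1 - |z|² ≤ 2 (1 - |z|) ≤ 2 |1 - z|`, which cancels one of the two powers
of `|1 - z|⁻¹`. -/
theorem resolventDefect_bound (hT1 : ‖T‖ ≤ 1) (n : ℕ) (z : spectrum ℂ T)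
    (hz : 1 - (z : ℂ) ≠ 0) :
    ‖(1 - ‖(z : ℂ)‖ ^ 2) *
      ‖resolventFun T hT1 ((n : ℝ) + 1)⁻¹ (by positivity) z - (1 - (z : ℂ))⁻¹‖ ^ 2‖
      ≤ 2 * ‖1 - (z : ℂ)‖⁻¹ := by
  have hz1 := norm_le_one_of_mem_spectrum hT1 z
  have h1 : 0 ≤ 1 - ‖(z : ℂ)‖ ^ 2 := by nlinarith [norm_nonneg (z : ℂ)]
  have h2 : 1 - ‖(z : ℂ)‖ ≤ ‖1 - (z : ℂ)‖ := by
    simpa using norm_sub_norm_le (1 : ℂ) z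
  have h3 : 1 - ‖(z : ℂ)‖ ^ 2 ≤ 2 * ‖1 - (z : ℂ)‖ := by nlinarith [norm_nonneg (z : ℂ)]
  have h4 : 0 < ‖1 - (z : ℂ)‖ := norm_pos_iff.mpr hz
  have hε : 0 < ((n : ℝ) + 1)⁻¹ := by positivity
  rw [Real.norm_of_nonneg (by positivity)]
  calc _ ≤ (2 * ‖1 - (z : ℂ)‖) * (‖1 - (z : ℂ)‖⁻¹) ^ 2 :=
        mul_le_mul h3 (pow_le_pow_left₀ (norm_nonneg _)
          (resolventFun_norm_sub_le hT1 hε z hz) 2) (by positivity) (by positivity)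
    _ = _ := by field_simp

theorem integrable_resolventDefect (hT1 : ‖T‖ ≤ 1)
    (h : ∫⁻ z, ‖1 - (z : ℂ)‖ₑ⁻¹ ∂spectrumMeasure T hT v < ∞) (n : ℕ) :
    Integrable (fun z : spectrum ℂ T => (1 - ‖(z : ℂ)‖ ^ 2) *
      ‖resolventFun T hT1 ((n : ℝ) + 1)⁻¹ (by positivity) z - (1 - (z : ℂ))⁻¹‖ ^ 2)
      (spectrumMeasure T hT v) := by
  refine ((integrable_inv_norm_one_sub h).const_mul 2).mono'
    (Measurable.aestronglyMeasurable ?_) ?_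
  · have := (resolventFun T hT1 ((n : ℝ) + 1)⁻¹ (by positivity)).continuous.measurable
    fun_prop
  · filter_upwards [ae_one_sub_ne_zero h] with z hz using resolventDefect_bound hT1 n z hz

theorem tendsto_resolventDefect (hT1 : ‖T‖ ≤ 1)
    (h : ∫⁻ z, ‖1 - (z : ℂ)‖ₑ⁻¹ ∂spectrumMeasure T hT v < ∞) :
    Tendsto (resolventDefect T hT hT1 v) atTop (𝓝 0) := by
  rw [← integral_zero (spectrum ℂ T) ℝ (μ := spectrumMeasure T hT v)]
  refine tendsto_integral_of_dominated_convergence (fun z => 2 * ‖1 - (z : ℂ)‖⁻¹)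
    (fun n => (integrable_resolventDefect hT1 h n).1)
    ((integrable_inv_norm_one_sub h).const_mul 2) (fun n => ?_) ?_
  · filter_upwards [ae_one_sub_ne_zero h] with z hz using resolventDefect_bound hT1 n z hz
  · filter_upwards [ae_one_sub_ne_zero h] with z hz
    simpa using (((tendsto_resolventFun hT1 z hz).sub_const (1 - (z : ℂ))⁻¹).norm.pow 2).const_mul
      (1 - ‖(z : ℂ)‖ ^ 2)

/-- The limit `(1 - z)⁻¹` need not be continuous on the spectrum, so no vector is attached to it by
the continuous calculus. The comparison is made under the integral, by `|a - b|² ≤ 2 (|a - c|² + |b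
- c|²)` with `c = (1 - z)⁻¹`. -/
theorem norm_resolventSeq_sub_sq_sub_le (hT1 : ‖T‖ ≤ 1)
    (h : ∫⁻ z, ‖1 - (z : ℂ)‖ₑ⁻¹ ∂spectrumMeasure T hT v < ∞) (m n : ℕ) :
    ‖resolventSeq T hT hT1 v m - resolventSeq T hT hT1 v n‖ ^ 2
      - ‖T (resolventSeq T hT hT1 v m - resolventSeq T hT hT1 v n)‖ ^ 2
      ≤ 2 * (resolventDefect T hT hT1 v m + resolventDefect T hT hT1 v n) := by
  have hs : resolventSeq T hT hT1 v m - resolventSeq T hT hT1 v n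
      = cfcHom hT (resolventFun T hT1 ((m : ℝ) + 1)⁻¹ (by positivity)
        - resolventFun T hT1 ((n : ℝ) + 1)⁻¹ (by positivity)) v := by
    rw [map_sub]
    rfl
  rw [hs, norm_cfcHom_sq_sub, resolventDefect, resolventDefect, ← integral_add
    (integrable_resolventDefect hT1 h m) (integrable_resolventDefect hT1 h n),
    ← integral_const_mul]
  refine integral_mono (Continuous.integrable_of_hasCompactSupport (by fun_prop)
    (HasCompactSupport.of_compactSpace _)) (((integrable_resolventDefect hT1 h m).add
      (integrable_resolventDefect hT1 h n)).const_mul 2) fun z => ?_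
  have hz1 := norm_le_one_of_mem_spectrum hT1 z
  have h1 : 0 ≤ 1 - ‖(z : ℂ)‖ ^ 2 := by nlinarith [norm_nonneg (z : ℂ)]
  dsimp only
  rw [← mul_add, mul_left_comm]
  refine mul_le_mul_of_nonneg_left ?_ h1
  rw [ContinuousMap.sub_apply, ← sub_sub_sub_cancel_right _ _ ((1 - (z : ℂ))⁻¹)]
  refine (pow_le_pow_left₀ (norm_nonneg _) (norm_sub_le _ _) 2).trans ?_
  exact add_sq_le

end Spectral

/-! ### The two-point law of a stationary Markov chain -/

section Chain

theorem measurable_pastSigma {Ω S : Type*} [mS : MeasurableSpace S] (ξ : ℤ → Ω → S) {i k : ℤ} (h : i ≤ k) :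
    Measurable[pastSigma ξ k] (ξ i) :=
  Measurable.mono (comap_measurable (ξ i))
    (le_iSup (fun j : {j : ℤ // j ≤ k} => MeasurableSpace.comap (ξ j) mS) ⟨i, h⟩) le_rfl

variable {Ω S : Type*} [mΩ : MeasurableSpace Ω] [mS : MeasurableSpace S]
  {P : Measure Ω} {ξ : ℤ → Ω → S} {π : Measure S} {Q : Kernel S S}

namespace IsStationaryMarkovChain

theorem map_shift (h : IsStationaryMarkovChain P ξ π Q) (k : ℤ) :
    P.map (ξ (k + 1)) = P.map (ξ k) := by
  have hm := h.stationary.measurable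
  have hs := congrArg (fun ν : Measure (ℤ → S) => ν.map (fun x => x k)) h.stationary.shift_law
  rw [Measure.map_map (measurable_pi_apply k) (measurable_pi_lambda _ fun k => hm (k + 1)),
    Measure.map_map (measurable_pi_apply k) (measurable_pi_lambda _ fun k => hm k)] at hs
  exact hs

theorem measurePreserving (h : IsStationaryMarkovChain P ξ π Q) (k : ℤ) :
    MeasurePreserving (ξ k) P π := by
  refine ⟨h.stationary.measurable k, ?_⟩
  induction k using Int.induction_on with
  | zero => exact h.law
  | succ i hi => rw [h.map_shift, hi]
  | pred i hi => rw [← hi, ← h.map_shift, sub_add_cancel]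

variable [IsProbabilityMeasure P]

theorem isProbabilityMeasure (h : IsStationaryMarkovChain P ξ π Q) : IsProbabilityMeasure π :=
  h.law ▸ Measure.isProbabilityMeasure_map (h.stationary.measurable 0).aemeasurable

variable [IsMarkovKernel Q]

/-- The Markov property for indicators, restated for laws: with an arbitrary past event `B` built
in, it yields conditional expectations of all `L²` functions. Rectangles suffice to identify the two
measures. -/
theorem map_pair_restrict (h : IsStationaryMarkovChain P ξ π Q) (k : ℤ) {B : Set Ω}
    (hB : MeasurableSet[pastSigma ξ k] B) :
    (P.restrict B).map (fun ω => (ξ k ω, ξ (k + 1) ω)) = (P.restrict B).map (ξ k) ⊗ₘ Q := by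
  have hm := h.stationary.measurable
  have hle := pastSigma_le hm k
  have hpair : Measurable fun ω => (ξ k ω, ξ (k + 1) ω) := (hm k).prodMk (hm (k + 1))
  refine Measure.ext_prod_iff.mpr fun {s t} hs ht => ?_
  have hB' : MeasurableSet[pastSigma ξ k] (ξ k ⁻¹' s ∩ B) :=
    (measurable_pastSigma ξ le_rfl hs).inter hB
  rw [Measure.map_apply hpair (hs.prod ht), Measure.compProd_apply_prod hs ht,
    setLIntegral_map hs (Q.measurable_coe ht) (hm k),
    Measure.restrict_restrict (hm k hs), Measure.restrict_apply (hpair (hs.prod ht))]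
  have e1 : ∫⁻ ω in ξ k ⁻¹' s ∩ B, Q (ξ k ω) t ∂P
      = ENNReal.ofReal (∫ ω in ξ k ⁻¹' s ∩ B, (Q (ξ k ω)).real t ∂P) := by
    rw [ofReal_integral_eq_lintegral_ofReal]
    · simp [Measure.real]
    · refine Integrable.of_bound ((Q.measurable_coe ht).comp
        (hm k)).ennreal_toReal.aestronglyMeasurable 1 (Eventually.of_forall fun ω => ?_)
      rw [Real.norm_of_nonneg measureReal_nonneg]
      exact measureReal_le_one
    · exact Eventually.of_forall fun ω => measureReal_nonneg
  have e2 : ∫ ω in ξ k ⁻¹' s ∩ B, (Q (ξ k ω)).real t ∂P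
      = P.real (ξ (k + 1) ⁻¹' t ∩ (ξ k ⁻¹' s ∩ B)) := by
    rw [← integral_congr_ae (ae_restrict_of_ae (h.markov k t ht)), setIntegral_condExp hle
      ((integrable_const (1 : ℝ)).indicator (hm _ ht)) hB', integral_indicator_const _ (hm _ ht)]
    simp [measureReal_restrict_apply (hm (k + 1) ht)]
  rw [e1, e2, ofReal_measureReal]
  congr 1
  ext ω
  simp only [Set.mem_inter_iff, Set.mem_preimage, Set.mem_prod]
  tauto

theorem measurePreserving_pair (h : IsStationaryMarkovChain P ξ π Q) (k : ℤ) :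
    MeasurePreserving (fun ω => (ξ k ω, ξ (k + 1) ω)) P (π ⊗ₘ Q) := by
  have hm := h.stationary.measurable
  refine ⟨(hm k).prodMk (hm (k + 1)), ?_⟩
  have := h.map_pair_restrict k (B := Set.univ) MeasurableSet.univ
  rwa [Measure.restrict_univ, (h.measurePreserving k).map_eq] at this

theorem condExp_comp (h : IsStationaryMarkovChain P ξ π Q) (k : ℤ) {g : S → ℂ}
    (hg : MemLp g 2 π) :
    P[fun ω => g (ξ (k + 1) ω) | pastSigma ξ k] =ᵐ[P] fun ω => ∫ y, g y ∂(Q (ξ k ω)) := by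
  have hm := h.stationary.measurable
  have hle := pastSigma_le hm k
  have hQg := memLp_kernel_integral h.invariant hg
  have hi : Integrable (fun ω => g (ξ (k + 1) ω)) P :=
    (hg.comp_measurePreserving (h.measurePreserving (k + 1))).integrable one_le_two
  have hiQ : Integrable (fun ω => ∫ y, g y ∂(Q (ξ k ω))) P :=
    (hQg.comp_measurePreserving (h.measurePreserving k)).integrable one_le_two
  refine (ae_eq_condExp_of_forall_setIntegral_eq hle hi (fun s _ _ => hiQ.integrableOn)
    (fun B hB _ => ?_) ?_).symm
  · have hpair : Measurable fun ω => (ξ k ω, ξ (k + 1) ω) := (hm k).prodMk (hm (k + 1))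
    have hmp := h.map_pair_restrict k hB
    -- `g` is measurable only up to `π`-null sets; absolute continuity carries this over to the
    -- restricted laws.
    have hac : (P.restrict B).map (ξ (k + 1)) ≪ π := by
      rw [← (h.measurePreserving (k + 1)).map_eq]
      exact Measure.absolutelyContinuous_of_le (Measure.map_mono Measure.restrict_le_self (hm _))
    have hac0 : (P.restrict B).map (ξ k) ≪ π := by
      rw [← (h.measurePreserving k).map_eq]
      exact Measure.absolutelyContinuous_of_le (Measure.map_mono Measure.restrict_le_self (hm _))
    have hacp : (P.restrict B).map (fun ω => (ξ k ω, ξ (k + 1) ω)) ≪ π ⊗ₘ Q := by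
      rw [← (h.measurePreserving_pair k).map_eq]
      exact Measure.absolutelyContinuous_of_le (Measure.map_mono Measure.restrict_le_self hpair)
    have hgs : AEStronglyMeasurable (fun p : S × S => g p.2)
        ((P.restrict B).map (fun ω => (ξ k ω, ξ (k + 1) ω))) := by
      refine AEStronglyMeasurable.comp_measurable (g := g) ?_ measurable_snd
      rw [Measure.map_map measurable_snd hpair]
      exact hg.1.mono_ac hac
    have hint : Integrable (fun p : S × S => g p.2) ((P.restrict B).map (ξ k) ⊗ₘ Q) := by
      rw [← hmp, integrable_map_measure hgs hpair.aemeasurable]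
      exact hi.integrableOn
    rw [← integral_map (f := fun x => ∫ y, g y ∂(Q x)) (hm k).aemeasurable (hQg.1.mono_ac hac0),
      ← Measure.integral_compProd hint, ← hmp, integral_map hpair.aemeasurable hgs]
  · obtain ⟨G, hG, hGe⟩ := hQg.1
    exact ⟨fun ω => G (ξ k ω), hG.comp_measurable (measurable_pastSigma ξ le_rfl),
      (h.measurePreserving k).quasiMeasurePreserving.ae_eq_comp hGe⟩

end IsStationaryMarkovChain

end Chain

/-! ### Martingale differences -/

section Differences

variable {S : Type*} [MeasurableSpace S] {π : Measure S} {Q : Kernel S S}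
  [IsMarkovKernel Q]

theorem measurePreserving_fst_compProd [SFinite π] :
    MeasurePreserving Prod.fst (π ⊗ₘ Q) π :=
  ⟨measurable_fst, Measure.fst_compProd π Q⟩

theorem measurePreserving_snd_compProd [SFinite π] (h : Q.Invariant π) :
    MeasurePreserving Prod.snd (π ⊗ₘ Q) π :=
  ⟨measurable_snd, (Measure.snd_compProd π Q).trans h.def⟩

theorem coeFn_markovOperator (h : Q.Invariant π) (g : Lp ℂ 2 π) :
    markovOperator h g =ᵐ[π] fun x => ∫ y, g y ∂(Q x) :=
  MemLp.coeFn_toLp (memLp_kernel_integral h (Lp.memLp g))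

theorem norm_markovOperator_le (h : Q.Invariant π) : ‖markovOperator h‖ ≤ 1 :=
  LinearMap.mkContinuous_norm_le _ zero_le_one _

/-- The function `(x, y) ↦ g y - (Q g) x` in `L²(π ⊗ Q)`. -/
noncomputable def differenceOp [SFinite π] (h : Q.Invariant π) :
    Lp ℂ 2 π →ₗ[ℂ] Lp ℂ 2 (π ⊗ₘ Q) :=
  (Lp.compMeasurePreservingₗᵢ ℂ Prod.snd (measurePreserving_snd_compProd h)).toLinearMap
    - (Lp.compMeasurePreservingₗᵢ ℂ Prod.fst measurePreserving_fst_compProd).toLinearMap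
      ∘ₗ (markovOperator h).toLinearMap

/-- Pythagoras: integrating first over `y` turns the cross term `⟪(Q g)(x), g(y)⟫` into `‖Q g‖²`. -/
theorem norm_differenceOp_sq [IsFiniteMeasure π] (h : Q.Invariant π) (g : Lp ℂ 2 π) :
    ‖differenceOp h g‖ ^ 2 = ‖g‖ ^ 2 - ‖markovOperator h g‖ ^ 2 := by
  set a := Lp.compMeasurePreservingₗᵢ ℂ Prod.snd (measurePreserving_snd_compProd h) g with ha
  set Tg := markovOperator h g with hTg
  set b := Lp.compMeasurePreservingₗᵢ ℂ Prod.fst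
    (measurePreserving_fst_compProd (π := π) (Q := Q)) Tg with hb
  have hna : ‖a‖ = ‖g‖ := LinearIsometry.norm_map _ _
  have hnb : ‖b‖ = ‖Tg‖ := LinearIsometry.norm_map _ _
  have hae : (fun p : S × S => inner ℂ (b p) (a p)) =ᵐ[π ⊗ₘ Q]
      fun p => inner ℂ (Tg p.1) (g p.2) := by
    filter_upwards [Lp.coeFn_compMeasurePreserving g (measurePreserving_snd_compProd h),
      Lp.coeFn_compMeasurePreserving Tg (measurePreserving_fst_compProd (π := π) (Q := Q))]
      with p h1 h2
    change inner ℂ ((Lp.compMeasurePreserving _ _ Tg : Lp ℂ 2 (π ⊗ₘ Q)) p)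
      ((Lp.compMeasurePreserving _ _ g : Lp ℂ 2 (π ⊗ₘ Q)) p) = _
    rw [h1, h2]
    rfl
  have hba : inner ℂ b a = inner ℂ Tg Tg := by
    rw [L2.inner_def, L2.inner_def, integral_congr_ae hae, Measure.integral_compProd
      ((integrable_congr hae).mp (L2.integrable_inner b a))]
    refine integral_congr_ae ?_
    filter_upwards [coeFn_markovOperator h g, ae_memLp_of_invariant h (Lp.memLp g)] with x hx hx2
    rw [integral_inner (hx2.integrable one_le_two), ← hx]
  have hd : differenceOp h g = a - b := rfl
  rw [hd, @norm_sub_sq ℂ, ← inner_conj_symm, hba, hna, hnb, inner_self_eq_norm_sq_to_K]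
  rw [RCLike.conj_re, ← RCLike.ofReal_pow, RCLike.ofReal_re]
  ring

end Differences

/-! ### Martingale differences along the chain -/

section Approximation

variable {Ω S : Type*} [mΩ : MeasurableSpace Ω] [mS : MeasurableSpace S]
  {P : Measure Ω} {ξ : ℤ → Ω → S} {π : Measure S} {Q : Kernel S S}

theorem norm_sq_eq_integral_norm_sq (u : Lp ℂ 2 P) : ‖u‖ ^ 2 = ∫ ω, ‖u ω‖ ^ 2 ∂P := by
  have h := L2.inner_def (𝕜 := ℂ) u u
  rw [inner_self_eq_norm_sq_to_K] at h
  have h2 : ∀ ω, inner ℂ (u ω) (u ω) = ((‖u ω‖ ^ 2 : ℝ) : ℂ) := fun ω => by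
    rw [inner_self_eq_norm_sq_to_K]
    norm_cast
  simp_rw [h2] at h
  exact_mod_cast h.trans integral_ofReal

theorem integral_re_sq_le (u : Lp ℂ 2 P) : ∫ ω, (u ω).re ^ 2 ∂P ≤ ‖u‖ ^ 2 := by
  rw [norm_sq_eq_integral_norm_sq]
  refine integral_mono_of_nonneg (Eventually.of_forall fun ω => sq_nonneg _)
    ((Lp.memLp u).integrable_norm_pow (by norm_num)) (Eventually.of_forall fun ω => ?_)
  exact sq_le_sq' (neg_le_of_abs_le (Complex.abs_re_le_norm _)) (Complex.re_le_norm _)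

namespace IsStationaryMarkovChain

/-- The isometry `g ↦ g (ξ k)` from `L²(π)` to `L²(P)`. -/
noncomputable def evalAt (h : IsStationaryMarkovChain P ξ π Q) (k : ℤ) :
    Lp ℂ 2 π →ₗᵢ[ℂ] Lp ℂ 2 P :=
  Lp.compMeasurePreservingₗᵢ ℂ (ξ k) (h.measurePreserving k)

theorem coeFn_evalAt (h : IsStationaryMarkovChain P ξ π Q) (k : ℤ) (g : Lp ℂ 2 π) :
    h.evalAt k g =ᵐ[P] fun ω => g (ξ k ω) :=
  Lp.coeFn_compMeasurePreserving g (h.measurePreserving k)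

/-- The pair process is the image of the path under a map that commutes with the shift. -/
theorem isStationaryProcess_pair (h : IsStationaryMarkovChain P ξ π Q) {d : S × S → ℝ}
    (hd : Measurable d) :
    IsStationaryProcess P fun k ω => (ξ k ω, d (ξ k ω, ξ (k + 1) ω)) := by
  have hm := h.stationary.measurable
  refine ⟨fun k => (hm k).prodMk (hd.comp ((hm k).prodMk (hm (k + 1)))), ?_⟩
  have hΦ : Measurable fun (x : ℤ → S) (k : ℤ) => (x k, d (x k, x (k + 1))) := by fun_prop
  have hs := congrArg (fun ν : Measure (ℤ → S) =>
    ν.map fun (x : ℤ → S) (k : ℤ) => (x k, d (x k, x (k + 1)))) h.stationary.shift_law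
  rwa [Measure.map_map hΦ (measurable_pi_lambda _ fun k => hm (k + 1)),
    Measure.map_map hΦ (measurable_pi_lambda _ fun k => hm k)] at hs

variable [IsProbabilityMeasure P]

theorem martingale_partialSum (h : IsStationaryMarkovChain P ξ π Q) {d : S × S → ℝ}
    (hd : Measurable d) (hd2 : ∀ k, MemLp (fun ω => d (ξ k ω, ξ (k + 1) ω)) 2 P)
    (hd0 : ∀ k, P[fun ω => d (ξ k ω, ξ (k + 1) ω) | pastSigma ξ k] =ᵐ[P] 0) :
    Martingale (partialSum fun k ω => d (ξ k ω, ξ (k + 1) ω))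
      (pastFiltration ξ h.stationary.measurable) P := by
  have hint : ∀ n, Integrable (partialSum (fun k ω => d (ξ k ω, ξ (k + 1) ω)) n) P := fun n =>
    integrable_finsetSum _ fun i _ => (hd2 i).integrable one_le_two
  refine martingale_of_condExp_sub_eq_zero_nat (fun n => ?_) hint fun n => ?_
  · refine Measurable.stronglyMeasurable ?_
    change Measurable[pastSigma ξ n] fun ω => ∑ i ∈ Finset.range n, d (ξ i ω, ξ (i + 1) ω)
    refine Finset.measurable_sum _ fun i hi => hd.comp ?_
    -- The `i`-th difference looks one step ahead, to `ξ (i + 1)`; for `i < n` this is still in the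
    -- past of `n`.
    have hin : (i : ℤ) + 1 ≤ n := by exact_mod_cast Finset.mem_range.mp hi
    exact (measurable_pastSigma ξ (by lia)).prodMk (measurable_pastSigma ξ hin)
  · refine EventuallyEq.trans (condExp_congr_ae (Eventually.of_forall fun ω => ?_)) (hd0 n)
    simp [partialSum, Finset.sum_range_succ]

variable [IsMarkovKernel Q]

/-- The isometry `d ↦ d (ξ k, ξ (k + 1))` from `L²(π ⊗ Q)` to `L²(P)`. -/
noncomputable def evalPair (h : IsStationaryMarkovChain P ξ π Q) (k : ℤ) :
    Lp ℂ 2 (π ⊗ₘ Q) →ₗᵢ[ℂ] Lp ℂ 2 P :=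
  Lp.compMeasurePreservingₗᵢ ℂ (fun ω => (ξ k ω, ξ (k + 1) ω)) (h.measurePreserving_pair k)

theorem coeFn_evalPair (h : IsStationaryMarkovChain P ξ π Q) (k : ℤ) (d : Lp ℂ 2 (π ⊗ₘ Q)) :
    h.evalPair k d =ᵐ[P] fun ω => d (ξ k ω, ξ (k + 1) ω) :=
  Lp.coeFn_compMeasurePreserving d (h.measurePreserving_pair k)

theorem evalPair_differenceOp [IsProbabilityMeasure π] (h : IsStationaryMarkovChain P ξ π Q)
    (k : ℤ) (g : Lp ℂ 2 π) :
    h.evalPair k (differenceOp h.invariant g)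
      = h.evalAt (k + 1) g - h.evalAt k (markovOperator h.invariant g) := by
  have h1 := Lp.coeFn_compMeasurePreserving g
    (measurePreserving_snd_compProd (π := π) h.invariant)
  have hd : differenceOp h.invariant g = Lp.compMeasurePreservingₗᵢ ℂ Prod.snd
      (measurePreserving_snd_compProd h.invariant) g - Lp.compMeasurePreservingₗᵢ ℂ Prod.fst
        measurePreserving_fst_compProd (markovOperator h.invariant g) := rfl
  have hq := (h.measurePreserving_pair k).quasiMeasurePreserving
  rw [hd, map_sub]
  congr 1
  refine Lp.ext ((h.coeFn_evalPair k _).trans (EventuallyEq.trans ?_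
    (h.coeFn_evalAt (k + 1) g).symm))
  exact hq.ae_eq_comp h1

theorem condExpL2_evalAt_succ (h : IsStationaryMarkovChain P ξ π Q) (k : ℤ) (g : Lp ℂ 2 π) :
    (condExpL2 ℂ ℂ (pastSigma_le h.stationary.measurable k) (h.evalAt (k + 1) g) : Lp ℂ 2 P)
      = h.evalAt k (markovOperator h.invariant g) := by
  have hmem : MemLp (fun ω => g (ξ (k + 1) ω)) 2 P :=
    (Lp.memLp g).comp_measurePreserving (h.measurePreserving (k + 1))
  have h1 : h.evalAt (k + 1) g = hmem.toLp _ :=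
    Lp.ext ((h.coeFn_evalAt (k + 1) g).trans hmem.coeFn_toLp.symm)
  rw [h1]
  refine Lp.ext (((hmem.condExpL2_ae_eq_condExp (𝕜 := ℂ) _).trans
    (h.condExp_comp k (Lp.memLp g))).trans (EventuallyEq.trans ?_ (h.coeFn_evalAt k _).symm))
  exact ((h.measurePreserving k).quasiMeasurePreserving.ae_eq_comp
    (coeFn_markovOperator h.invariant g)).symm

/-- The difference is `u - E[u | 𝓕 k]` with `u = g(ξ (k + 1))`, and the conditional expectation is
idempotent. -/
theorem condExpL2_evalPair_differenceOp [IsProbabilityMeasure π]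
    (h : IsStationaryMarkovChain P ξ π Q) (k : ℤ) (g : Lp ℂ 2 π) :
    condExpL2 ℂ ℂ (pastSigma_le h.stationary.measurable k)
      (h.evalPair k (differenceOp h.invariant g)) = 0 := by
  rw [h.evalPair_differenceOp, map_sub, ← h.condExpL2_evalAt_succ, sub_eq_zero]
  have : Fact (pastSigma ξ k ≤ mΩ) := ⟨pastSigma_le h.stationary.measurable k⟩
  exact (Submodule.orthogonalProjectionOnto_mem_subspace_eq_self (K := lpMeas ℂ ℂ _ 2 P)
    (condExpL2 ℂ ℂ (pastSigma_le h.stationary.measurable k) (h.evalAt (k + 1) g))).symm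

/-! ### Orthogonality of the differences and the approximation error. -/

theorem evalPair_mem_lpMeas (h : IsStationaryMarkovChain P ξ π Q) {i j : ℤ} (hij : i < j)
    (d : Lp ℂ 2 (π ⊗ₘ Q)) : h.evalPair i d ∈ lpMeas ℂ ℂ (pastSigma ξ j) 2 P := by
  rw [mem_lpMeas_iff_aestronglyMeasurable]
  exact ⟨_, (Lp.stronglyMeasurable d).comp_measurable ((measurable_pastSigma ξ hij.le).prodMk
    (measurable_pastSigma ξ (Int.add_one_le_of_lt hij))), h.coeFn_evalPair i d⟩

theorem inner_evalPair_eq_zero (h : IsStationaryMarkovChain P ξ π Q) {i j : ℤ} (hij : i < j)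
    {d e : Lp ℂ 2 (π ⊗ₘ Q)}
    (he : condExpL2 ℂ ℂ (pastSigma_le h.stationary.measurable j) (h.evalPair j e) = 0) :
    inner ℂ (h.evalPair i d) (h.evalPair j e) = 0 := by
  have : Fact (pastSigma ξ j ≤ mΩ) := ⟨pastSigma_le h.stationary.measurable j⟩
  exact (Submodule.mem_orthogonal _ _).mp
    ((Submodule.orthogonalProjectionOnto_eq_zero_iff (K := lpMeas ℂ ℂ (pastSigma ξ j) 2 P)).mp he) _
    (h.evalPair_mem_lpMeas hij d)

theorem norm_sum_evalPair_sq (h : IsStationaryMarkovChain P ξ π Q) {e : Lp ℂ 2 (π ⊗ₘ Q)}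
    (he : ∀ k, condExpL2 ℂ ℂ (pastSigma_le h.stationary.measurable k) (h.evalPair k e) = 0)
    (n : ℕ) : ‖∑ i ∈ Finset.range n, h.evalPair i e‖ ^ 2 = n * ‖e‖ ^ 2 := by
  induction n with
  | zero => simp
  | succ n ih =>
    have h0 : inner ℂ (∑ i ∈ Finset.range n, h.evalPair i e) (h.evalPair n e) = 0 := by
      rw [sum_inner]
      exact Finset.sum_eq_zero fun i hi => h.inner_evalPair_eq_zero
        (by exact_mod_cast Finset.mem_range.mp hi) (he n)
    rw [Finset.sum_range_succ, @norm_add_sq ℂ, h0, ih, LinearIsometry.norm_map]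
    simp
    ring

theorem sum_evalAt_sub_sum_evalPair [IsProbabilityMeasure π]
    (h : IsStationaryMarkovChain P ξ π Q) {v g : Lp ℂ 2 π} {ε : ℝ}
    (hg : v = (1 + (ε : ℂ)) • g - markovOperator h.invariant g) (d : Lp ℂ 2 (π ⊗ₘ Q)) (n : ℕ) :
    ∑ i ∈ Finset.range n, h.evalAt i v - ∑ i ∈ Finset.range n, h.evalPair i d
      = ∑ i ∈ Finset.range n, h.evalPair i (differenceOp h.invariant g - d)
        + (h.evalAt 0 g - h.evalAt n g) + (ε : ℂ) • ∑ i ∈ Finset.range n, h.evalAt i g := by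
  induction n with
  | zero => simp
  | succ n ih =>
    have hv : h.evalAt n v = h.evalAt n g + (ε : ℂ) • h.evalAt n g
        - h.evalAt n (markovOperator h.invariant g) := by
      rw [hg, map_sub, map_smul, add_smul, one_smul]
    have hsplit : ∀ a b c e : Lp ℂ 2 P, (a + b) - (c + e) = (a - c) + (b - e) := fun a b c e => by
      abel
    rw [Finset.sum_range_succ, Finset.sum_range_succ, hsplit, ih, Finset.sum_range_succ,
      Finset.sum_range_succ, hv, map_sub, h.evalPair_differenceOp, smul_add]
    push_cast
    abel

/-- The martingale part has orthogonal summands and so costs only `n` squared norms. The boundary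
terms contribute `2 ‖g‖` and the `ε` term at most `n ε ‖g‖ ≤ ‖g‖`, whence `9 = 3²`; the factor `2`
is from `(a + b)² ≤ 2 (a² + b²)`. -/
theorem norm_sum_evalAt_sub_le [IsProbabilityMeasure π]
    (h : IsStationaryMarkovChain P ξ π Q) {v g : Lp ℂ 2 π} {ε : ℝ} (hε : 0 ≤ ε)
    (hg : v = (1 + (ε : ℂ)) • g - markovOperator h.invariant g) {d : Lp ℂ 2 (π ⊗ₘ Q)}
    (hd : ∀ k, condExpL2 ℂ ℂ (pastSigma_le h.stationary.measurable k) (h.evalPair k d) = 0)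
    (n : ℕ) (hn : n * ε ≤ 1) :
    ‖∑ i ∈ Finset.range n, h.evalAt i v - ∑ i ∈ Finset.range n, h.evalPair i d‖ ^ 2
      ≤ 2 * (n * ‖differenceOp h.invariant g - d‖ ^ 2 + 9 * ‖g‖ ^ 2) := by
  rw [h.sum_evalAt_sub_sum_evalPair hg, add_assoc]
  have h1 : ‖(h.evalAt 0 g - h.evalAt n g)
      + (ε : ℂ) • ∑ i ∈ Finset.range n, h.evalAt i g‖ ≤ 3 * ‖g‖ := by
    have h2 : ‖∑ i ∈ Finset.range n, h.evalAt i g‖ ≤ n * ‖g‖ := by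
      refine (norm_sum_le _ _).trans ?_
      simp
    have h3 : ‖(ε : ℂ) • ∑ i ∈ Finset.range n, h.evalAt i g‖ ≤ ‖g‖ := by
      rw [norm_smul, Complex.norm_real, Real.norm_of_nonneg hε]
      calc _ ≤ ε * (n * ‖g‖) := mul_le_mul_of_nonneg_left h2 hε
        _ = (n * ε) * ‖g‖ := by ring
        _ ≤ ‖g‖ := mul_le_of_le_one_left (norm_nonneg _) hn
    have h4 : ‖h.evalAt 0 g - h.evalAt n g‖ ≤ ‖g‖ + ‖g‖ :=
      (norm_sub_le _ _).trans (by rw [LinearIsometry.norm_map, LinearIsometry.norm_map])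
    linarith [norm_add_le (h.evalAt 0 g - h.evalAt n g)
      ((ε : ℂ) • ∑ i ∈ Finset.range n, h.evalAt i g)]
  have h5 := h.norm_sum_evalPair_sq (e := differenceOp h.invariant g - d) (fun k => by
    rw [map_sub, map_sub, h.condExpL2_evalPair_differenceOp, hd, sub_zero]) n
  refine (pow_le_pow_left₀ (norm_nonneg _) (norm_add_le _ _) 2).trans (add_sq_le.trans ?_)
  rw [h5]
  have h6 := pow_le_pow_left₀ (norm_nonneg _) h1 2
  rw [mul_pow] at h6
  linarith

theorem exists_difference [IsProbabilityMeasure π] (h : IsStationaryMarkovChain P ξ π Q)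
    (hT : IsStarNormal (markovOperator h.invariant)) (v : Lp ℂ 2 π)
    (hv : ∫⁻ z, ‖1 - (z : ℂ)‖ₑ⁻¹ ∂spectrumMeasure (markovOperator h.invariant) hT v < ∞) :
    ∃ d : Lp ℂ 2 (π ⊗ₘ Q),
      (∀ k, condExpL2 ℂ ℂ (pastSigma_le h.stationary.measurable k) (h.evalPair k d) = 0) ∧
      Tendsto (fun n : ℕ => ‖∑ i ∈ Finset.range n, h.evalAt i v
        - ∑ i ∈ Finset.range n, h.evalPair i d‖ ^ 2 / n) atTop (𝓝 0) := by
  have hT1 := norm_markovOperator_le h.invariant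
  set g := resolventSeq (markovOperator h.invariant) hT hT1 v with hg
  have ha := tendsto_resolventDefect hT1 hv
  set a := resolventDefect (markovOperator h.invariant) hT hT1 v
  have hcauchy : CauchySeq fun n => differenceOp h.invariant (g n) := by
    refine Metric.cauchySeq_iff'.mpr fun ε hε => ?_
    -- With both defects below `ε² / 4`, the bound `2 (a n + a N)` stays below `ε²`.
    obtain ⟨N, hN⟩ := (ha.eventually (gt_mem_nhds (show 0 < ε ^ 2 / 4 by positivity))).exists_forall_of_atTop
    refine ⟨N, fun n hn => ?_⟩
    have h1 := norm_resolventSeq_sub_sq_sub_le hT1 hv n N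
    rw [← norm_differenceOp_sq, map_sub] at h1
    rw [dist_eq_norm]
    refine lt_of_pow_lt_pow_left₀ 2 hε.le (h1.trans_lt ?_)
    linarith [hN n hn, hN N le_rfl]
  obtain ⟨d, hd⟩ := cauchySeq_tendsto_of_complete hcauchy
  -- Vanishing conditional expectation is a closed condition, so it passes to the limit `d`.
  have hd0 : ∀ k, condExpL2 ℂ ℂ (pastSigma_le h.stationary.measurable k)
      (h.evalPair k d) = 0 := fun k => by
    have hc : Continuous fun e => condExpL2 ℂ ℂ (pastSigma_le h.stationary.measurable k)
        (h.evalPair k e) :=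
      (ContinuousLinearMap.continuous _).comp (h.evalPair k).continuous
    refine tendsto_nhds_unique ((hc.tendsto d).comp hd) ?_
    simp only [Function.comp_def, h.condExpL2_evalPair_differenceOp]
    exact tendsto_const_nhds
  refine ⟨d, hd0, ?_⟩
  have hb := tendsto_norm_resolventSeq (hT := hT) hT1 hv
  have hlim : Tendsto (fun n : ℕ => 2 * ‖differenceOp h.invariant (g n) - d‖ ^ 2
      + 36 * (((n : ℝ) + 1)⁻¹ * ‖g n‖ ^ 2)) atTop (𝓝 0) := by
    have := (((tendsto_iff_norm_sub_tendsto_zero.mp hd).pow 2).const_mul 2).add (hb.const_mul 36)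
    simpa using this
  refine squeeze_zero' (Eventually.of_forall fun n => by positivity) ?_ hlim
  filter_upwards [eventually_ge_atTop 1] with n hn
  have hn' : (1 : ℝ) ≤ n := by exact_mod_cast hn
  -- The resolvent parameter is tied to the horizon: `ε = 1 / (n + 1)` gives `n ε ≤ 1`, and `1 / n ≤
  -- 2 ε` then turns `18 ‖g n‖² / n` into `36 ε ‖g n‖²`.
  have h1 := h.norm_sum_evalAt_sub_le (ε := ((n : ℝ) + 1)⁻¹) (by positivity)
    (resolventVec_eq _ hT hT1 v ((n : ℝ) + 1)⁻¹ (by positivity)) hd0 n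
    (by rw [← div_eq_mul_inv]; exact div_le_one_of_le₀ (by linarith) (by positivity))
  change _ ≤ 2 * (n * ‖differenceOp h.invariant (g n) - d‖ ^ 2 + 9 * ‖g n‖ ^ 2) at h1
  refine (div_le_div_of_nonneg_right h1 (by positivity)).trans ?_
  have h2 : (n : ℝ)⁻¹ ≤ 2 * ((n : ℝ) + 1)⁻¹ := by
    rw [← div_eq_mul_inv, inv_eq_one_div, div_le_div_iff₀ (by positivity) (by positivity)]
    linarith
  have h3 := mul_le_mul_of_nonneg_right h2 (sq_nonneg ‖g n‖)
  have h4 : 2 * (n * ‖differenceOp h.invariant (g n) - d‖ ^ 2 + 9 * ‖g n‖ ^ 2) / (n : ℝ)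
      = 2 * ‖differenceOp h.invariant (g n) - d‖ ^ 2 + 18 * ((n : ℝ)⁻¹ * ‖g n‖ ^ 2) := by
    field_simp
    ring
  rw [h4]
  linarith

theorem condExp_re_eq_zero (h : IsStationaryMarkovChain P ξ π Q) {d : Lp ℂ 2 (π ⊗ₘ Q)} (k : ℤ)
    (hd : condExpL2 ℂ ℂ (pastSigma_le h.stationary.measurable k) (h.evalPair k d) = 0) :
    P[fun ω => (d (ξ k ω, ξ (k + 1) ω)).re | pastSigma ξ k] =ᵐ[P] 0 := by
  have hmem : MemLp (fun ω => d (ξ k ω, ξ (k + 1) ω)) 2 P :=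
    (Lp.memLp d).comp_measurePreserving (h.measurePreserving_pair k)
  have h1 : h.evalPair k d = hmem.toLp _ :=
    Lp.ext ((h.coeFn_evalPair k d).trans hmem.coeFn_toLp.symm)
  have h2 := hmem.condExpL2_ae_eq_condExp (𝕜 := ℂ) (pastSigma_le h.stationary.measurable k)
  rw [← h1, hd] at h2
  have h3 := Complex.reCLM.comp_condExp_comm (m := pastSigma ξ k) (hmem.integrable one_le_two)
  refine h3.symm.trans ?_
  filter_upwards [h2, Lp.coeFn_zero ℂ 2 P] with ω h4 h5
  rw [Function.comp_apply, ← h4]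
  change Complex.reCLM ((0 : Lp ℂ 2 P) ω) = 0
  rw [h5]
  simp

end IsStationaryMarkovChain

end Approximation

/-! ### The main theorem. -/

theorem mainTheorem10 {Ω S : Type*} [MeasurableSpace Ω] [MeasurableSpace S]
    (P : Measure Ω) [IsProbabilityMeasure P] (ξ : ℤ → Ω → S) (π : Measure S)
    (Q : Kernel S S) [IsMarkovKernel Q] (hξ : IsStationaryMarkovChain P ξ π Q)
    (hnormal : IsStarNormal (markovOperator hξ.invariant))
    (f : S → ℝ) (hf : MemLp f 2 π) (hf0 : ∫ x, f x ∂π = 0)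
    (hspec : ∫⁻ z in Metric.closedBall (0 : ℂ) 1, ‖1 - z‖ₑ⁻¹
      ∂(spectralMeasure (markovOperator hξ.invariant) hnormal (hf.ofReal (K := ℂ)).toLp) < ∞) :
    HasMartingaleApproximation P ξ hξ.stationary.measurable (fun k ω => f (ξ k ω)) := by
  have := hξ.isProbabilityMeasure
  rw [lintegral_spectralMeasure (norm_markovOperator_le _) (by fun_prop)] at hspec
  set F := (hf.ofReal (K := ℂ)).toLp with hF
  obtain ⟨d, hd0, hd⟩ := hξ.exists_difference hnormal _ hspec
  have hdm : Measurable fun p => (d p).re :=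
    Complex.measurable_re.comp (Lp.stronglyMeasurable d).measurable
  have hd2 : ∀ k, MemLp (fun ω => (d (ξ k ω, ξ (k + 1) ω)).re) 2 P := fun k =>
    ((Lp.memLp d).comp_measurePreserving (hξ.measurePreserving_pair k)).re
  refine ⟨fun k ω => (d (ξ k ω, ξ (k + 1) ω)).re, hd2, hξ.isStationaryProcess_pair hdm,
    hξ.martingale_partialSum hdm hd2 fun k => hξ.condExp_re_eq_zero k (hd0 k), ?_⟩
  refine squeeze_zero (fun n => div_nonneg (integral_nonneg fun ω => sq_nonneg _) n.cast_nonneg)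
    (fun n => div_le_div_of_nonneg_right ?_ n.cast_nonneg) hd
  -- As `f` is real, the error for the real part of `d` is the real part of the complex error, and
  -- so has no larger norm.
  refine le_trans (le_of_eq (integral_congr_ae ?_)) (integral_re_sq_le _)
  have h1 : ∀ᵐ ω ∂P, ∀ i : ℤ, hξ.evalAt i F ω = (f (ξ i ω) : ℂ) :=
    ae_all_iff.mpr fun i => (hξ.coeFn_evalAt i _).trans
      ((hξ.measurePreserving i).quasiMeasurePreserving.ae_eq_comp (hf.ofReal (K := ℂ)).coeFn_toLp)
  filter_upwards [h1, ae_all_iff.mpr fun i : ℤ => hξ.coeFn_evalPair i d,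
    Lp.coeFn_sub (∑ i ∈ Finset.range n, hξ.evalAt i F)
      (∑ i ∈ Finset.range n, hξ.evalPair i d),
    Lp.coeFn_finsetSum (Finset.range n) fun i : ℕ => hξ.evalAt i F,
    Lp.coeFn_finsetSum (Finset.range n) fun i : ℕ => hξ.evalPair i d] with ω h2 h3 h4 h5 h6
  rw [h4, Pi.sub_apply, h5, h6]
  simp [partialSum, h2, h3]
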